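/- Let $X$ be a Banach space over $\mathbb{K}$, where $\mathbb{K}=\mathbb{R}$ or $\mathbb{K}=\mathbb{C}$, with unit sphere $S_X$ and dual $X^*$. The pair $(X,\mathbb{K})$ is said to have property $\mathbf{L}_{o,p}$ if for every $\varepsilon>0$ and every $x\in S_X$ there is $\eta(\varepsilon,x)>0$ such that, whenever $x^*\in X^*$ satisfies $\|x^*\|=1$ and $|x^*(x)|>1-\eta(\varepsilon,x)$, there is $x_0\in S_X$ with $|x^*(x_0)|=1$ and $\|x_0-x\|<\varepsilon$. The space $X$ is locally uniformly rotund if for all $x,x_n\in S_X$ ($n\in\mathbb{N}$), $\lim_n\|x_n+x\|=2$ implies $\lim_n\|x_n-x\|=0$; it is strictly convex if $\left\|\frac{x+y}{2}\right\|<1$ for all $x,y\in S_X$ with $x\neq y$. It has the Radon–Nikodým property if for every finite measure space $(\Omega,\Sigma,\mu)$ and every countably additive $m:\Sigma\to X$ of bounded variation that is absolutely continuous with respect to $\mu$ there is a Bochner integrable $f:\Omega\to X$ with $m(E)=\int_E f\,d\mu$ for all $E\in\Sigma$. (i) If $X$ is reflexive and locally uniformly rotund, then the pair $(X,\mathbb{K})$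 has property $\mathbf{L}_{o,p}$. (ii) If $X$ has the Radon–Nikodým property and the pair $(X,\mathbb{K})$ has property $\mathbf{L}_{o,p}$, then $X$ is strictly convex. -/

import Mathlib

open MeasureTheory Filter Topology
open scoped MeasureTheory

/-- A normed space is reflexive if the canonical embedding into its bidual is onto. -/
def IsReflexiveSpace (𝕜 X : Type*) [RCLike 𝕜] [NormedAddCommGroup X] [NormedSpace 𝕜 X] : Prop :=
  Function.Surjective (NormedSpace.inclusionInDoubleDual 𝕜 X)

/-- Local uniform rotundity (LUR): for all `x, u n` in the unit sphere,
`‖u n + x‖ → 2` implies `‖u n - x‖ → 0`. -/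
def IsLocallyUniformlyRotund (X : Type*) [NormedAddCommGroup X] : Prop :=
  ∀ x : X, ‖x‖ = 1 → ∀ u : ℕ → X, (∀ n, ‖u n‖ = 1) →
    Tendsto (fun n => ‖u n + x‖) atTop (𝓝 2) → Tendsto (fun n => ‖u n - x‖) atTop (𝓝 0)

/-- Strict convexity: the midpoint of two distinct points of the unit sphere has norm `< 1`.
(Here `2⁻¹` is the scalar `1/2` of the ground field.) -/
def IsStrictlyConvexSpace (𝕜 X : Type*) [RCLike 𝕜] [NormedAddCommGroup X]
    [NormedSpace 𝕜 X] : Prop :=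
  ∀ x y : X, ‖x‖ = 1 → ‖y‖ = 1 → x ≠ y → ‖(2⁻¹ : 𝕜) • (x + y)‖ < 1

/-- Property `L_{o,p}` of a pair `(X, Y)`: for every `ε > 0` and every `x` in the unit sphere of
`X` there is `η > 0` (depending on `ε` and `x` only) such that every norm-one operator `T` with
`‖T x‖ > 1 - η` attains its norm at a point `x₀` of the unit sphere with `‖x₀ - x‖ < ε`. -/
def HasPropertyLop (𝕜 X Y : Type*) [RCLike 𝕜] [NormedAddCommGroup X] [NormedSpace 𝕜 X]
    [NormedAddCommGroup Y] [NormedSpace 𝕜 Y] : Prop :=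
  ∀ ε : ℝ, 0 < ε → ∀ x : X, ‖x‖ = 1 → ∃ η : ℝ, 0 < η ∧
    ∀ T : X →L[𝕜] Y, ‖T‖ = 1 → 1 - η < ‖T x‖ →
      ∃ x₀ : X, ‖x₀‖ = 1 ∧ ‖T x₀‖ = 1 ∧ ‖x₀ - x‖ < ε

/-- The Radon–Nikodým property: for every finite measure space `(Ω, Σ, μ)`, every countably
additive `m : Σ → X` of bounded variation (finite total variation) that vanishes on `μ`-null sets
is the indefinite Bochner integral of some `f ∈ L¹(μ; X)`. (It is classical that Lebesgue measure
on `[0, 1]` alone already decides the property, so the universe of `Ω` plays no role.) -/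
def HasRadonNikodymProperty (X : Type*) [NormedAddCommGroup X] [NormedSpace ℝ X] : Prop :=
  ∀ (Ω : Type) (_ : MeasurableSpace Ω) (μ : Measure Ω) (_ : IsFiniteMeasure μ)
    (m : VectorMeasure Ω X), IsFiniteMeasure m.variation → m ≪ᵥ μ.toENNRealVectorMeasure →
      ∃ f : Ω → X, Integrable f μ ∧ ∀ E : Set Ω, MeasurableSet E → m E = ∫ ω in E, f ω ∂μ

/-! (i) If `T` has norm one and nearly attains it at `x`, reflexivity gives a norming point of `T`;
rotated to the phase of `T x`, this point plus `x` has norm close to 2, so LUR puts it near `x`.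

(ii) If the midpoint of `x ≠ y` has norm 1, a functional `f` norming it satisfies `f x = f y = 1`,
and `L_{o,p}` makes every functional near `f` attain its norm both near `x` and near `y`. The
Radon–Nikodým property forbids this: by `exists_not_attains_away`, some functional near `f` attains
its norm only within `δ` of a single point `p`.

That lemma replaces the density of strongly exposing functionals. If it failed, Hahn–Banach
separation (`exists_convexHull_sub_cone_near`) would make each `p` in the ball, up to a small error,
an average of points at distance at least `δ` from `p`, minus some `k` with `r * ‖k‖ ≤ F k`.
Iterating with independent randomness gives a bounded process with jumps at least `δ`. Its drift `k`
raises `F` by at least `r * ‖k‖`; as `F` is bounded on the ball, the total drift is summable. Such a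
quasimartingale converges in `L¹` under the Radon–Nikodým property, which contradicts the jumps. -/

/-! ### Cone separation and convex combinations. -/

/-- A functional that is nonnegative on the cone `{k | r * ‖k‖ ≤ F k}` is, up to a positive factor,
within `r` of `F`. -/
theorem exists_smul_norm_sub_le {X : Type*} [NormedAddCommGroup X] [NormedSpace ℝ X]
    {F G : X →L[ℝ] ℝ} {r : ℝ} (hr : 0 ≤ r) (hrF : r < ‖F‖) (hG : G ≠ 0)
    (hGK : ∀ k, r * ‖k‖ ≤ F k → 0 ≤ G k) : ∃ t : ℝ, 0 < t ∧ ‖t • G - F‖ ≤ r := by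
  -- `φ` is superlinear and the cone is `{φ ≥ 0}`. A real `t` with `φ ≤ t • G` suffices: evaluating
  -- at `x` and `-x` bounds `|t * G x - F x|` by `r * ‖x‖`.
  let φ : X → ℝ := fun x => F x - r * ‖x‖
  have φ_smul : ∀ (a : ℝ) x, 0 ≤ a → φ (a • x) = a * φ x := fun a x ha => by
    simp only [φ, map_smul, smul_eq_mul, norm_smul, Real.norm_of_nonneg ha]; ring
  have φ_add : ∀ x y, φ x + φ y ≤ φ (x + y) := fun x y => by
    simp only [φ, map_add]
    nlinarith [norm_add_le x y]
  obtain ⟨w, hw⟩ : ∃ w, G w = 1 := by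
    obtain ⟨v, hv⟩ : ∃ v, G v ≠ 0 := by
      by_contra! h
      exact hG (ContinuousLinearMap.ext h)
    exact ⟨(G v)⁻¹ • v, by simp [hv]⟩
  have key : ∀ z, G z = 0 → φ z ≤ 0 := by
    intro z hz
    by_contra! hpos
    -- So small that `z - a • w` stays in the cone, although `G` equals `-a < 0` there.
    let a : ℝ := φ z / (|φ (-w)| + 1)
    have ha : 0 < a := by positivity
    have h1 : 0 ≤ φ (z + a • -w) := by
      have h2 := φ_add z (a • -w)
      rw [φ_smul _ _ ha.le] at h2
      have h3 : a * (|φ (-w)| + 1) = φ z := by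
        simp only [a]; field_simp
      nlinarith [neg_abs_le (φ (-w))]
    have h4 := hGK (z + a • -w) (by simp only [φ] at h1; linarith)
    simp [hz, hw] at h4
    linarith
  have hle : ∀ x y, G x = 1 → G y = -1 → φ x ≤ -φ y := by
    intro x y hx hy
    have := key (x + y) (by simp [hx, hy])
    linarith [φ_add x y]
  let S : Set ℝ := φ '' {x | G x = 1}
  have hSne : S.Nonempty := ⟨φ w, w, hw, rfl⟩
  have hSb : BddAbove S := ⟨-φ (-w), by
    rintro _ ⟨x, hx, rfl⟩
    exact hle x _ hx (by simp [hw])⟩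
  have hmain : ∀ x, φ x ≤ sSup S * G x := by
    intro x
    rcases lt_trichotomy (G x) 0 with h | h | h
    · have hu : sSup S ≤ -φ ((-G x)⁻¹ • x) := by
        refine csSup_le hSne ?_
        rintro _ ⟨z, hz, rfl⟩
        refine hle z _ hz ?_
        rw [map_smul, smul_eq_mul, inv_neg, neg_mul, inv_mul_cancel₀ h.ne]
      rw [φ_smul _ _ (inv_nonneg.2 (by linarith))] at hu
      have h5 : -G x * ((-G x)⁻¹ * φ x) = φ x := by
        rw [← mul_assoc, mul_inv_cancel₀ (by linarith), one_mul]
      nlinarith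
    · simpa [h] using key x h
    · have hu : φ ((G x)⁻¹ • x) ≤ sSup S :=
        le_csSup hSb ⟨_, by simp [h.ne'], rfl⟩
      rw [φ_smul _ _ (inv_nonneg.2 h.le)] at hu
      have h5 : G x * ((G x)⁻¹ * φ x) = φ x := by
        rw [← mul_assoc, mul_inv_cancel₀ h.ne', one_mul]
      nlinarith
  have hnorm : ‖sSup S • G - F‖ ≤ r := by
    refine ContinuousLinearMap.opNorm_le_bound _ hr fun x => ?_
    have h1 := hmain x
    have h2 := hmain (-x)
    simp only [φ, map_neg, norm_neg] at h1 h2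
    rw [Real.norm_eq_abs, abs_le]
    simp only [sub_apply, smul_apply, smul_eq_mul]
    constructor <;> linarith
  -- Since `r < ‖F‖` the cone has a point with `φ > 0`, which forces the factor to be positive.
  obtain ⟨x, hx⟩ : ∃ x, 0 < φ x := by
    by_contra! h
    refine hrF.not_ge (ContinuousLinearMap.opNorm_le_bound _ hr fun x => ?_)
    have h1 := h x
    have h2 := h (-x)
    simp only [φ, map_neg, norm_neg] at h1 h2
    rw [Real.norm_eq_abs, abs_le]
    constructor <;> linarith
  refine ⟨sSup S, ?_, hnorm⟩
  have h1 : 0 ≤ G x := hGK x (by simp only [φ] at hx; linarith)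
  have h2 := hmain x
  by_contra! h
  nlinarith

open scoped Pointwise in
/-- If all functionals near `F` attain their norm on the unit ball away from `p`, then `p` is
approximated by convex combinations of points of the ball away from `p`, up to subtracting an
element of the cone `{k | r * ‖k‖ ≤ F k}`. -/
theorem exists_convexHull_sub_cone_near {X : Type*} [NormedAddCommGroup X] [NormedSpace ℝ X]
    {F : X →L[ℝ] ℝ} {r δ : ℝ} (hr : 0 ≤ r) (hrF : r < ‖F‖) {p : X} (hp : ‖p‖ ≤ 1)
    (h : ∀ G : X →L[ℝ] ℝ, ‖G - F‖ ≤ r → ∃ z, ‖z‖ ≤ 1 ∧ δ ≤ ‖z - p‖ ∧ G z = ‖G‖)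
    {e : ℝ} (he : 0 < e) :
    ∃ q ∈ convexHull ℝ {z : X | ‖z‖ ≤ 1 ∧ δ ≤ ‖z - p‖}, ∃ k, r * ‖k‖ ≤ F k ∧ ‖q - k - p‖ < e := by
  let S : Set X := {z : X | ‖z‖ ≤ 1 ∧ δ ≤ ‖z - p‖}
  let K : Set X := {k | r * ‖k‖ ≤ F k}
  have hK : Convex ℝ K := by
    intro x hx y hy a b ha hb _
    simp only [K, Set.mem_ofPred_eq, map_add, map_smul, smul_eq_mul] at *
    have := norm_add_le (a • x) (b • y)
    rw [norm_smul, norm_smul, Real.norm_of_nonneg ha, Real.norm_of_nonneg hb] at this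
    nlinarith [mul_le_mul_of_nonneg_left hx ha, mul_le_mul_of_nonneg_left hy hb,
      mul_le_mul_of_nonneg_left this hr]
  -- A separating `G` is nonnegative on `K`, so a multiple `t • G` lies within `r` of `F` and
  -- attains its norm at some `z ∈ S`; but separation gives `G z < G p`, impossible for `p` in the
  -- ball.
  have hmem : p ∈ closure (convexHull ℝ S - K) := by
    by_contra hp'
    obtain ⟨G, u, hGu, huG⟩ := geometric_hahn_banach_closed_point
      (((convex_convexHull ℝ S).sub hK).closure) isClosed_closure hp'
    have hGS : ∀ s ∈ S, ∀ k ∈ K, G s - G k < u := fun s hs k hk => by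
      rw [← map_sub]
      exact hGu _ (subset_closure (Set.sub_mem_sub (subset_convexHull ℝ S hs) hk))
    obtain ⟨s, hs1, hs2, -⟩ := h F (by simpa using hr)
    have hs : s ∈ S := ⟨hs1, hs2⟩
    have h0K : (0 : X) ∈ K := by simp [K]
    have hG0 : G ≠ 0 := by
      rintro rfl
      have := hGS s hs 0 h0K
      simp at this huG
      linarith
    have hGK : ∀ k, r * ‖k‖ ≤ F k → 0 ≤ G k := by
      intro k hk
      by_contra! hneg
      obtain ⟨n, hn⟩ := exists_nat_gt ((u - G s) / -G k)
      have hnk : (n : ℝ) • k ∈ K := by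
        simp only [K, Set.mem_ofPred_eq, map_smul, smul_eq_mul, norm_smul, RCLike.norm_natCast]
        nlinarith [mul_le_mul_of_nonneg_left hk (Nat.cast_nonneg (α := ℝ) n)]
      have h1 := hGS s hs _ hnk
      rw [div_lt_iff₀ (by linarith)] at hn
      simp only [map_smul, smul_eq_mul] at h1
      linarith
    obtain ⟨t, ht, htG⟩ := exists_smul_norm_sub_le hr hrF hG0 hGK
    obtain ⟨z, hz1, hz2, hz3⟩ := h (t • G) htG
    have h2 := hGS z ⟨hz1, hz2⟩ 0 h0K
    have h3 : (t • G) p ≤ ‖t • G‖ :=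
      ((le_abs_self _).trans ((t • G).le_opNorm p)).trans
        (mul_le_of_le_one_right (norm_nonneg _) hp)
    rw [← hz3] at h3
    simp only [smul_apply, smul_eq_mul, map_zero, sub_zero] at h2 h3
    nlinarith
  obtain ⟨_, ⟨q, hq, k, hk, rfl⟩, hd⟩ := Metric.mem_closure_iff.1 hmem e he
  exact ⟨q, hq, k, hk, by rwa [dist_comm, dist_eq_norm] at hd⟩

/-- Every finite convex combination is the mean of a simple function on the unit interval. -/
theorem exists_simpleFunc_integral_eq_of_mem_convexHull {X : Type*} [NormedAddCommGroup X]
    [NormedSpace ℝ X] [CompleteSpace X] {S : Set X} {q : X} (hq : q ∈ convexHull ℝ S) :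
    ∃ s : SimpleFunc unitInterval X, (∀ u, s u ∈ S) ∧ ∫ u, s u = q := by
  classical
  rw [mem_convexHull_iff_exists_fintype] at hq
  obtain ⟨ι, _, w, z, hw0, hw1, hz, rfl⟩ := hq
  let _ : MeasurableSpace ι := ⊤
  let ν : Measure ι := ∑ i, ENNReal.ofReal (w i) • Measure.dirac i
  have hν : IsProbabilityMeasure ν := ⟨by
    simp only [ν, Measure.coe_finsetSum, Finset.sum_apply, Measure.smul_apply, measure_univ,
      smul_eq_mul, mul_one]
    rw [← ENNReal.ofReal_sum_of_nonneg fun i _ => hw0 i, hw1, ENNReal.ofReal_one]⟩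
  have : StandardBorelSpace ι := inferInstance
  have hfin : ∀ i, IsFiniteMeasure (ENNReal.ofReal (w i) • Measure.dirac i : Measure ι) :=
    fun i => ⟨by simp⟩
  have hι : Nonempty ι := by
    by_contra h
    rw [not_nonempty_iff] at h
    simp at hw1
  -- The discrete law `ν` is realised as the law of a function of one uniform variable.
  obtain ⟨f, hf, hfν⟩ := ν.exists_measurable_map_eq
  refine ⟨SimpleFunc.comp ⟨z, fun _ => trivial, Set.finite_range z⟩ f hf, fun u => hz _, ?_⟩
  change ∫ u, z (f u) = _
  rw [← integral_map (φ := f) (f := z) hf.aemeasurable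
    (StronglyMeasurable.of_discrete).aestronglyMeasurable, hfν]
  rw [integral_finsetSum_measure fun i _ => Integrable.of_finite]
  refine Finset.sum_congr rfl fun i _ => ?_
  rw [integral_smul_measure, integral_dirac, ENNReal.toReal_ofReal (hw0 i)]

/-! ### Approximation along a generating filtration. -/

section Approximation

variable {Ω : Type*} {mΩ : MeasurableSpace Ω} {μ : Measure Ω} [IsFiniteMeasure μ]
  {X : Type*} [NormedAddCommGroup X] {𝓕 : ℕ → MeasurableSpace Ω}

/-- Measurable sets of a union of an increasing sequence of σ-algebras are approximated by sets of
the individual σ-algebras. -/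
theorem exists_measurableSet_symmDiff_lt (hmono : Monotone 𝓕) (hsup : ⨆ n, 𝓕 n = mΩ)
    {E : Set Ω} (hE : MeasurableSet E) {ε : ℝ} (hε : 0 < ε) :
    ∃ n A, MeasurableSet[𝓕 n] A ∧ μ.real (symmDiff A E) < ε := by
  have hring : IsSetRing {s | ∃ n, MeasurableSet[𝓕 n] s} := by
    refine ⟨⟨0, @MeasurableSet.empty _ (𝓕 0)⟩, ?_, ?_⟩
    · rintro s t ⟨n, hs⟩ ⟨k, ht⟩
      exact ⟨max n k, (hmono (le_max_left n k) _ hs).union (hmono (le_max_right n k) _ ht)⟩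
    · rintro s t ⟨n, hs⟩ ⟨k, ht⟩
      exact ⟨max n k, (hmono (le_max_left n k) _ hs).diff (hmono (le_max_right n k) _ ht)⟩
  obtain ⟨A, ⟨n, hA⟩, h⟩ := exists_measure_symmDiff_lt_of_generateFrom_isSetRing (μ := μ) hring
    ⟨{Set.univ}, Set.countable_singleton _, by
      rintro _ rfl; exact ⟨0, @MeasurableSet.univ _ (𝓕 0)⟩, by simp⟩
    (by rw [← hsup, MeasurableSpace.measurableSpace_iSup_eq]) hE (ENNReal.ofReal_pos.2 hε)
  exact ⟨n, A, hA, (ENNReal.lt_ofReal_iff_toReal_lt (measure_ne_top _ _)).1 h⟩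

/-- Finite-valued strongly measurable functions are integrable for a finite measure. -/
theorem integrable_of_finite_range {f : Ω → X} (hf : StronglyMeasurable f)
    (hfin : (Set.range f).Finite) : Integrable f μ := by
  obtain ⟨C, hC⟩ := (hfin.image norm).bddAbove
  exact Integrable.of_bound hf.aestronglyMeasurable C
    (ae_of_all _ fun ω => hC ⟨f ω, ⟨ω, rfl⟩, rfl⟩)

/-- Integrable functions are approximated in `L¹` by finite-valued functions measurable with respect
to one of the σ-algebras of a generating increasing sequence. -/
theorem exists_finite_range_integral_norm_sub_lt [NormedSpace ℝ X]
    (hmono : Monotone 𝓕) (hsup : ⨆ n, 𝓕 n = mΩ)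
    {f : Ω → X} (hf : Integrable f μ) {ε : ℝ} (hε : 0 < ε) :
    ∃ (n : ℕ) (g : Ω → X), StronglyMeasurable[𝓕 n] g ∧ (Set.range g).Finite ∧
      ∫ ω, ‖f ω - g ω‖ ∂μ < ε := by
  have hle : ∀ n, 𝓕 n ≤ mΩ := fun n => hsup ▸ le_iSup 𝓕 n
  revert ε
  refine Integrable.induction (μ := μ) (fun f : Ω → X => ∀ {ε : ℝ}, 0 < ε →
    ∃ (n : ℕ) (g : Ω → X), StronglyMeasurable[𝓕 n] g ∧ (Set.range g).Finite ∧
      ∫ ω, ‖f ω - g ω‖ ∂μ < ε) ?_ ?_ ?_ ?_ hf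
  · intro c s hs _ ε hε
    obtain ⟨n, A, hA, h⟩ := exists_measurableSet_symmDiff_lt (μ := μ) hmono hsup hs
      (ε := ε / (‖c‖ + 1)) (by positivity)
    refine ⟨n, A.indicator fun _ => c, stronglyMeasurable_const.indicator hA, ?_, ?_⟩
    · refine (Set.toFinite {0, c}).subset ?_
      rintro _ ⟨ω, rfl⟩
      by_cases hω : ω ∈ A <;> simp [hω]
    · have h1 : ∀ ω, ‖s.indicator (fun _ => c) ω - A.indicator (fun _ => c) ω‖
          = (symmDiff A s).indicator (fun _ => ‖c‖) ω := by
        intro ω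
        by_cases h1 : ω ∈ A <;> by_cases h2 : ω ∈ s <;> simp [h1, h2, Set.mem_symmDiff]
      simp_rw [h1]
      rw [integral_indicator (((hle n) _ hA).symmDiff hs), setIntegral_const, smul_eq_mul]
      rw [lt_div_iff₀ (by positivity)] at h
      nlinarith [measureReal_nonneg (μ := μ) (s := symmDiff A s)]
  · intro f g _ hf hg hPf hPg ε hε
    obtain ⟨n, f', hf', hff, h1⟩ := hPf (half_pos hε)
    obtain ⟨k, g', hg', hgf, h2⟩ := hPg (half_pos hε)
    refine ⟨max n k, f' + g', (hf'.mono (hmono (le_max_left _ _))).add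
      (hg'.mono (hmono (le_max_right _ _))), ?_, ?_⟩
    · refine (hff.image2 (· + ·) hgf).subset ?_
      rintro _ ⟨ω, rfl⟩
      exact ⟨_, ⟨ω, rfl⟩, _, ⟨ω, rfl⟩, rfl⟩
    · have i1 := (hf.sub (integrable_of_finite_range (hf'.mono (hle n)) hff)).norm
      have i2 := (hg.sub (integrable_of_finite_range (hg'.mono (hle k)) hgf)).norm
      calc ∫ ω, ‖(f + g) ω - (f' + g') ω‖ ∂μ
          ≤ ∫ ω, (‖f ω - f' ω‖ + ‖g ω - g' ω‖) ∂μ := by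
            refine integral_mono_of_nonneg (ae_of_all _ fun _ => norm_nonneg _) (i1.add i2)
              (ae_of_all _ fun ω => ?_)
            simp only [Pi.add_apply]
            rw [add_sub_add_comm]
            exact norm_add_le _ _
        _ = ∫ ω, ‖f ω - f' ω‖ ∂μ + ∫ ω, ‖g ω - g' ω‖ ∂μ := integral_add i1 i2
        _ < ε := by linarith
  · rw [← isSeqClosed_iff_isClosed]
    intro u f hu huf ε hε
    obtain ⟨j, hj⟩ := (huf.eventually (Metric.ball_mem_nhds f (half_pos hε))).exists
    obtain ⟨n, g, hg, hgf, h1⟩ := hu j (half_pos hε)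
    refine ⟨n, g, hg, hgf, ?_⟩
    have hj' : ∫ ω, ‖f ω - u j ω‖ ∂μ < ε / 2 := by
      rw [dist_comm, L1.dist_eq_integral_dist] at hj
      simpa only [dist_eq_norm] using hj
    have i1 := ((L1.integrable_coeFn f).sub (L1.integrable_coeFn (u j))).norm
    have i2 := ((L1.integrable_coeFn (u j)).sub
      (integrable_of_finite_range (hg.mono (hle n)) hgf)).norm
    calc ∫ ω, ‖f ω - g ω‖ ∂μ
        ≤ ∫ ω, (‖f ω - u j ω‖ + ‖u j ω - g ω‖) ∂μ :=
          integral_mono_of_nonneg (ae_of_all _ fun _ => norm_nonneg _) (i1.add i2)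
            (ae_of_all _ fun ω => norm_sub_le_norm_sub_add_norm_sub _ _ _)
      _ = ∫ ω, ‖f ω - u j ω‖ ∂μ + ∫ ω, ‖u j ω - g ω‖ ∂μ := integral_add i1 i2
      _ < ε := by linarith
  · intro f f' hff' _ hP ε hε
    obtain ⟨n, g, hg, hgf, h⟩ := hP hε
    refine ⟨n, g, hg, hgf, lt_of_eq_of_lt (integral_congr_ae ?_) h⟩
    filter_upwards [hff'] with ω hω
    rw [hω]

/-- For a finite-valued function, the `L¹` norm is a finite sum of norms of integrals. -/
theorem exists_finset_integral_norm_eq [NormedSpace ℝ X] [CompleteSpace X] {m₀ : MeasurableSpace Ω} (hm : m₀ ≤ mΩ)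
    {h : Ω → X} (hh : StronglyMeasurable[m₀] h) (hfin : (Set.range h).Finite) :
    ∃ P : Finset (Set Ω), (∀ A ∈ P, MeasurableSet[m₀] A) ∧
      (P : Set (Set Ω)).PairwiseDisjoint id ∧ (⋃ A ∈ P, A) = Set.univ ∧
      ∫ ω, ‖h ω‖ ∂μ = ∑ A ∈ P, ‖∫ ω in A, h ω ∂μ‖ := by
  classical
  -- On each fibre `h` is constant, so there the norm commutes with the integral.
  let P : Finset (Set Ω) := hfin.toFinset.image fun c => h ⁻¹' {c}
  have hP : ∀ A ∈ P, ∃ c, A = h ⁻¹' {c} := by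
    intro A hA
    obtain ⟨c, -, rfl⟩ := Finset.mem_image.1 hA
    exact ⟨c, rfl⟩
  have hmeas : ∀ A ∈ P, MeasurableSet[m₀] A := by
    intro A hA
    obtain ⟨c, rfl⟩ := hP A hA
    exact hh.measurableSet_eq_fun stronglyMeasurable_const
  have hdisj : (P : Set (Set Ω)).PairwiseDisjoint id := by
    intro A hA B hB hAB
    obtain ⟨a, rfl⟩ := hP A hA
    obtain ⟨b, rfl⟩ := hP B hB
    refine Set.disjoint_left.2 fun ω h1 h2 => hAB ?_
    simp only [id, Set.mem_preimage, Set.mem_singleton_iff] at h1 h2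
    rw [← h1, ← h2]
  have hcov : (⋃ A ∈ P, A) = Set.univ := by
    refine Set.eq_univ_of_forall fun ω => Set.mem_iUnion₂.2 ⟨h ⁻¹' {h ω}, ?_, rfl⟩
    exact Finset.mem_image.2 ⟨h ω, by simp, rfl⟩
  refine ⟨P, hmeas, hdisj, hcov, ?_⟩
  have hint := (integrable_of_finite_range (μ := μ) (hh.mono hm) hfin).norm
  rw [← setIntegral_univ, ← hcov, integral_biUnion_finset P (fun A hA => hm _ (hmeas A hA)) hdisj
    fun A _ => hint.integrableOn]
  refine Finset.sum_congr rfl fun A hA => ?_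
  have hA' := hm _ (hmeas A hA)
  obtain ⟨c, rfl⟩ := hP A hA
  rw [setIntegral_congr_fun (g := fun _ => c) hA' fun ω hω => hω,
    setIntegral_congr_fun (g := fun _ => ‖c‖) hA' fun ω hω => congrArg norm hω]
  simp [norm_smul, abs_of_nonneg measureReal_nonneg]

end Approximation

/-! ### Bounded quasimartingales and the Radon–Nikodým property. -/

section Quasimartingale

variable {Ω : Type*} {mΩ : MeasurableSpace Ω} {μ : Measure Ω}
  {X : Type*} [NormedAddCommGroup X] [NormedSpace ℝ X] {𝓕 : ℕ → MeasurableSpace Ω}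
  {M : ℕ → Ω → X} {d : ℕ → Ω → ℝ}

/-- `hdM` expresses a bound `d n` on the conditional drift through set integrals alone. A set of `𝓕
n` belongs to all later σ-algebras, so the bounds telescope. -/
theorem norm_setIntegral_sub_le_of_increments (hmono : Monotone 𝓕)
    (hdM : ∀ n A, MeasurableSet[𝓕 n] A →
      ‖∫ ω in A, M (n + 1) ω ∂μ - ∫ ω in A, M n ω ∂μ‖ ≤ ∫ ω in A, d n ω ∂μ)
    {n k : ℕ} (hnk : n ≤ k) {A : Set Ω} (hA : MeasurableSet[𝓕 n] A) :
    ‖∫ ω in A, M k ω ∂μ - ∫ ω in A, M n ω ∂μ‖ ≤ ∑ j ∈ Finset.Ico n k, ∫ ω in A, d j ω ∂μ := by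
  induction k, hnk using Nat.le_induction with
  | base => simp
  | succ k hk ih =>
    rw [Finset.sum_Ico_succ_top hk]
    calc _ ≤ ‖∫ ω in A, M (k + 1) ω ∂μ - ∫ ω in A, M k ω ∂μ‖
          + ‖∫ ω in A, M k ω ∂μ - ∫ ω in A, M n ω ∂μ‖ := norm_sub_le_norm_sub_add_norm_sub _ _ _
      _ ≤ _ := by linarith [hdM k A (hmono hk _ hA)]

variable [IsFiniteMeasure μ]

theorem norm_setIntegral_le_measureReal {f : Ω → X} (hf : ∀ ω, ‖f ω‖ ≤ 1) (E : Set Ω) :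
    ‖∫ ω in E, f ω ∂μ‖ ≤ μ.real E := by
  simpa using norm_setIntegral_le_of_norm_le_const (measure_lt_top μ E) (fun ω _ => hf ω)

/-- Set integrals of a bounded quasimartingale converge. -/
theorem cauchySeq_setIntegral_of_increments (hmono : Monotone 𝓕) (hsup : ⨆ n, 𝓕 n = mΩ)
    (hM : ∀ n, StronglyMeasurable[𝓕 n] (M n)) (hbd : ∀ n ω, ‖M n ω‖ ≤ 1)
    (hd0 : ∀ n ω, 0 ≤ d n ω) (hdi : ∀ n, Integrable (d n) μ)
    (hdM : ∀ n A, MeasurableSet[𝓕 n] A →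
      ‖∫ ω in A, M (n + 1) ω ∂μ - ∫ ω in A, M n ω ∂μ‖ ≤ ∫ ω in A, d n ω ∂μ)
    (hsum : Summable fun n => ∫ ω, d n ω ∂μ) {E : Set Ω} (hE : MeasurableSet E) :
    CauchySeq fun n => ∫ ω in E, M n ω ∂μ := by
  have hle : ∀ n, 𝓕 n ≤ mΩ := fun n => hsup ▸ le_iSup 𝓕 n
  have hMi : ∀ n, Integrable (M n) μ := fun n =>
    Integrable.of_bound ((hM n).mono (hle n)).aestronglyMeasurable 1 (ae_of_all _ (hbd n))
  rw [Metric.cauchySeq_iff']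
  intro ε hε
  obtain ⟨n₀, A, hA, hAE⟩ := exists_measurableSet_symmDiff_lt (μ := μ) hmono hsup hE
    (ε := ε / 8) (by positivity)
  -- The bound `‖M n‖ ≤ 1` makes the cost of replacing `E` by `A` uniform in `n`.
  have happrox : ∀ n, ‖∫ ω in E, M n ω ∂μ - ∫ ω in A, M n ω ∂μ‖ ≤ ε / 4 := by
    intro n
    have h1 := integral_inter_add_sdiff (f := M n) (μ := μ) (hle _ _ hA) (hMi n).integrableOn
      (s := E)
    have h2 := integral_inter_add_sdiff (f := M n) (μ := μ) hE (hMi n).integrableOn (s := A)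
    rw [← h1, ← h2, Set.inter_comm, add_sub_add_left_eq_sub]
    have h3 := norm_setIntegral_le_measureReal (μ := μ) (hbd n) (E \ A)
    have h4 := norm_setIntegral_le_measureReal (μ := μ) (hbd n) (A \ E)
    have h5 : μ.real (E \ A) ≤ μ.real (symmDiff A E) :=
      measureReal_mono (fun ω h => Or.inr h)
    have h6 : μ.real (A \ E) ≤ μ.real (symmDiff A E) :=
      measureReal_mono (fun ω h => Or.inl h)
    have := norm_sub_le (∫ ω in E \ A, M n ω ∂μ) (∫ ω in A \ E, M n ω ∂μ)
    linarith
  obtain ⟨n₁, hn₁⟩ := Metric.tendsto_atTop.1 (tendsto_sum_nat_add fun n => ∫ ω, d n ω ∂μ)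
    (ε / 4) (by positivity)
  let n := max n₀ n₁
  refine ⟨n, fun k hk => ?_⟩
  have h1 : ‖∫ ω in A, M k ω ∂μ - ∫ ω in A, M n ω ∂μ‖ < ε / 4 := by
    refine (norm_setIntegral_sub_le_of_increments hmono hdM hk
      (hmono (le_max_left n₀ n₁) _ hA)).trans_lt ?_
    have h2 := hn₁ n (le_max_right _ _)
    rw [Real.dist_0_eq_abs] at h2
    refine lt_of_le_of_lt ?_ ((le_abs_self _).trans_lt h2)
    calc ∑ j ∈ Finset.Ico n k, ∫ ω in A, d j ω ∂μ
        ≤ ∑ j ∈ Finset.Ico n k, ∫ ω, d j ω ∂μ := Finset.sum_le_sum fun j _ =>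
          setIntegral_le_integral (hdi j) (ae_of_all _ (hd0 j))
      _ = ∑ j ∈ Finset.range (k - n), ∫ ω, d (j + n) ω ∂μ := by
          rw [Finset.sum_Ico_eq_sum_range]
          simp only [add_comm]
      _ ≤ _ := ((summable_nat_add_iff n).2 hsum).sum_le_tsum _
          fun j _ => integral_nonneg (hd0 _)
  rw [dist_eq_norm]
  have e1 := happrox k
  have e2 := happrox n
  have := norm_add₃_le (a := ∫ ω in E, M k ω ∂μ - ∫ ω in A, M k ω ∂μ)
    (b := ∫ ω in A, M k ω ∂μ - ∫ ω in A, M n ω ∂μ)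
    (c := -(∫ ω in E, M n ω ∂μ - ∫ ω in A, M n ω ∂μ))
  rw [norm_neg] at this
  calc _ = _ := congrArg norm (by abel)
    _ ≤ _ := this
    _ < ε := by linarith

end Quasimartingale

/-- In a space with the Radon–Nikodým property, a bounded quasimartingale with finitely-valued terms
cannot have increments bounded away from zero. -/
theorem HasRadonNikodymProperty.false_of_separated_quasimartingale {X : Type*}
    [NormedAddCommGroup X] [NormedSpace ℝ X] [CompleteSpace X] (hX : HasRadonNikodymProperty X)
    {Ω : Type} {mΩ : MeasurableSpace Ω} {μ : Measure Ω} [IsProbabilityMeasure μ]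
    {𝓕 : ℕ → MeasurableSpace Ω} {M : ℕ → Ω → X} {d : ℕ → Ω → ℝ}
    (hmono : Monotone 𝓕) (hsup : ⨆ n, 𝓕 n = mΩ)
    (hM : ∀ n, StronglyMeasurable[𝓕 n] (M n)) (hfin : ∀ n, (Set.range (M n)).Finite)
    (hbd : ∀ n ω, ‖M n ω‖ ≤ 1)
    (hd0 : ∀ n ω, 0 ≤ d n ω) (hdi : ∀ n, Integrable (d n) μ)
    (hdM : ∀ n A, MeasurableSet[𝓕 n] A →
      ‖∫ ω in A, M (n + 1) ω ∂μ - ∫ ω in A, M n ω ∂μ‖ ≤ ∫ ω in A, d n ω ∂μ)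
    (hsum : Summable fun n => ∫ ω, d n ω ∂μ)
    {δ : ℝ} (hδ : 0 < δ) (hsep : ∀ n ω, δ ≤ ‖M (n + 1) ω - M n ω‖) : False := by
  classical
  have hle : ∀ n, 𝓕 n ≤ mΩ := fun n => hsup ▸ le_iSup 𝓕 n
  have hMi : ∀ n, Integrable (M n) μ := fun n =>
    integrable_of_finite_range ((hM n).mono (hle n)) (hfin n)
  have hlim : ∀ E, MeasurableSet E → ∃ l, Tendsto (fun n => ∫ ω in E, M n ω ∂μ) atTop (𝓝 l) :=
    fun E hE => cauchySeq_tendsto_of_complete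
      (cauchySeq_setIntegral_of_increments hmono hsup hM hbd hd0 hdi hdM hsum hE)
  choose! l hl using hlim
  let v : Set Ω → X := fun E => if MeasurableSet E then l E else 0
  have hv : ∀ E, MeasurableSet E → Tendsto (fun n => ∫ ω in E, M n ω ∂μ) atTop (𝓝 (v E)) :=
    fun E hE => by simpa [v, hE] using hl E hE
  -- This domination yields countable additivity from finite additivity, as well as bounded
  -- variation and absolute continuity.
  have hvle : ∀ E, ‖v E‖ₑ ≤ μ E := by
    intro E
    by_cases hE : MeasurableSet E
    · rw [← ofReal_norm, ← ofReal_measureReal]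
      exact ENNReal.ofReal_le_ofReal (le_of_tendsto (hv E hE).norm
        (Eventually.of_forall fun n => norm_setIntegral_le_measureReal (hbd n) E))
    · simp [v, hE]
  let m : VectorMeasure Ω X := VectorMeasure.of_additive_of_le_measure (μ := μ) v hvle
    (fun s t hs ht hst => tendsto_nhds_unique (hv _ (hs.union ht)) <| by
      refine ((hv s hs).add (hv t ht)).congr fun n => ?_
      rw [setIntegral_union hst ht (hMi n).integrableOn (hMi n).integrableOn])
    (fun s hs => by simp [v, hs])
  have hmv : ∀ E, m E = v E := fun E => rfl
  have hvar : IsFiniteMeasure m.variation :=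
    isFiniteMeasure_of_le μ (VectorMeasure.variation_le_of_forall_enorm_le fun E _ => hvle E)
  have hac : m ≪ᵥ μ.toENNRealVectorMeasure := by
    intro E hE
    by_cases hE' : MeasurableSet E
    · rw [Measure.toENNRealVectorMeasure_apply_measurable hE'] at hE
      have := hvle E
      rw [hE] at this
      simpa [hmv] using this
    · exact m.not_measurable hE'
  obtain ⟨f, hf, hmf⟩ := hX Ω mΩ μ inferInstance m hvar hac
  let r : ℕ → ℝ := fun n => ∑' j, ∫ ω, d (j + n) ω ∂μ
  have hr : Tendsto r atTop (𝓝 0) := tendsto_sum_nat_add fun n => ∫ ω, d n ω ∂μ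
  -- The bound `r n` is the drift remaining after time `n`; it does not depend on the partition,
  -- which is what allows passage to `L¹` norms.
  have hpart : ∀ n (P : Finset (Set Ω)), (∀ A ∈ P, MeasurableSet[𝓕 n] A) →
      (P : Set (Set Ω)).PairwiseDisjoint id → (⋃ A ∈ P, A) = Set.univ →
      ∑ A ∈ P, ‖∫ ω in A, f ω ∂μ - ∫ ω in A, M n ω ∂μ‖ ≤ r n := by
    intro n P hP hdisj hcov
    have hlimP : Tendsto (fun k => ∑ A ∈ P, ‖∫ ω in A, M k ω ∂μ - ∫ ω in A, M n ω ∂μ‖) atTop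
        (𝓝 (∑ A ∈ P, ‖∫ ω in A, f ω ∂μ - ∫ ω in A, M n ω ∂μ‖)) := by
      refine tendsto_finsetSum _ fun A hA => ?_
      have hA' := hle _ _ (hP A hA)
      rw [← hmf A hA', hmv]
      exact ((hv A hA').sub_const _).norm
    refine le_of_tendsto hlimP ?_
    filter_upwards [eventually_ge_atTop n] with k hk
    calc ∑ A ∈ P, ‖∫ ω in A, M k ω ∂μ - ∫ ω in A, M n ω ∂μ‖
        ≤ ∑ A ∈ P, ∑ j ∈ Finset.Ico n k, ∫ ω in A, d j ω ∂μ := Finset.sum_le_sum fun A hA =>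
          norm_setIntegral_sub_le_of_increments hmono hdM hk (hP A hA)
      _ = ∑ j ∈ Finset.Ico n k, ∫ ω, d j ω ∂μ := by
          rw [Finset.sum_comm]
          refine Finset.sum_congr rfl fun j _ => ?_
          rw [← integral_biUnion_finset P (fun A hA => hle _ _ (hP A hA)) hdisj
            fun A _ => (hdi j).integrableOn, hcov, setIntegral_univ]
      _ = ∑ j ∈ Finset.range (k - n), ∫ ω, d (j + n) ω ∂μ := by
          rw [Finset.sum_Ico_eq_sum_range]
          simp only [add_comm]
      _ ≤ r n := ((summable_nat_add_iff n).2 hsum).sum_le_tsum _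
          fun j _ => integral_nonneg (hd0 _)
  obtain ⟨n₀, g, hg, hgfin, hfg⟩ := exists_finite_range_integral_norm_sub_lt (μ := μ) hmono hsup hf
    (ε := δ / 4) (by positivity)
  have hgi : Integrable g μ := integrable_of_finite_range (hg.mono (hle n₀)) hgfin
  -- For `n ≥ n₀` the difference `M n - g` is finite-valued and `𝓕 n`-measurable, so its `L¹` norm
  -- is a sum over a partition to which `hpart` applies.
  have hclose : ∀ n, n₀ ≤ n → ∫ ω, ‖M n ω - g ω‖ ∂μ ≤ r n + ∫ ω, ‖f ω - g ω‖ ∂μ := by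
    intro n hn
    obtain ⟨P, hP, hdisj, hcov, heq⟩ := exists_finset_integral_norm_eq (μ := μ) (hle n)
      (h := fun ω => M n ω - g ω) ((hM n).sub (hg.mono (hmono hn)))
      (((hfin n).image2 (· - ·) hgfin).subset (by
        rintro _ ⟨ω, rfl⟩
        exact ⟨_, ⟨ω, rfl⟩, _, ⟨ω, rfl⟩, rfl⟩))
    have hsplit : ∫ ω, ‖f ω - g ω‖ ∂μ = ∑ A ∈ P, ∫ ω in A, ‖f ω - g ω‖ ∂μ := by
      have hi : Integrable (fun ω => ‖f ω - g ω‖) μ := (hf.sub hgi).norm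
      rw [← integral_biUnion_finset P (fun A hA => hle _ _ (hP A hA)) hdisj
        fun A _ => hi.integrableOn, hcov, setIntegral_univ]
    rw [heq, hsplit]
    calc ∑ A ∈ P, ‖∫ ω in A, (M n ω - g ω) ∂μ‖
        ≤ ∑ A ∈ P, (‖∫ ω in A, f ω ∂μ - ∫ ω in A, M n ω ∂μ‖ + ∫ ω in A, ‖f ω - g ω‖ ∂μ) := by
          refine Finset.sum_le_sum fun A _ => ?_
          have h1 : ∫ ω in A, (M n ω - g ω) ∂μ =
              ∫ ω in A, (f ω - g ω) ∂μ - (∫ ω in A, f ω ∂μ - ∫ ω in A, M n ω ∂μ) := by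
            rw [integral_sub (hMi n).integrableOn hgi.integrableOn,
              integral_sub hf.integrableOn hgi.integrableOn]
            abel
          rw [h1]
          have := norm_sub_le (∫ ω in A, (f ω - g ω) ∂μ)
            (∫ ω in A, f ω ∂μ - ∫ ω in A, M n ω ∂μ)
          linarith [norm_integral_le_integral_norm (μ := μ.restrict A) fun ω => f ω - g ω]
      _ ≤ _ := by
          rw [Finset.sum_add_distrib]
          linarith [hpart n P hP hdisj hcov]
  obtain ⟨n₁, hn₁⟩ := Metric.tendsto_atTop.1 hr (δ / 4) (by positivity)
  have hr' : ∀ n, n₁ ≤ n → r n < δ / 4 := fun n hn => by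
    have := hn₁ n hn
    rw [Real.dist_0_eq_abs] at this
    exact (le_abs_self _).trans_lt this
  let n := max n₀ n₁
  have e1 := hclose n (le_max_left _ _)
  have e2 := hclose (n + 1) ((le_max_left _ _).trans (Nat.le_succ _))
  have e3 := hr' n (le_max_right _ _)
  have e4 := hr' (n + 1) ((le_max_right _ _).trans (Nat.le_succ _))
  have i1 := ((hMi n).sub hgi).norm
  have i2 := ((hMi (n + 1)).sub hgi).norm
  have : δ ≤ ∫ ω, ‖M (n + 1) ω - g ω‖ ∂μ + ∫ ω, ‖M n ω - g ω‖ ∂μ := by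
    calc δ = ∫ _, δ ∂μ := by simp
      _ ≤ ∫ ω, (‖M (n + 1) ω - g ω‖ + ‖M n ω - g ω‖) ∂μ := by
        refine integral_mono (integrable_const _) (i2.add i1) fun ω => ?_
        refine (hsep n ω).trans ?_
        change _ ≤ ‖M (n + 1) ω - g ω‖ + ‖M n ω - g ω‖
        rw [norm_sub_rev (M n ω)]
        exact norm_sub_le_norm_sub_add_norm_sub _ _ _
      _ = _ := integral_add i2 i1
  linarith

/-! ### The random construction driven by independent uniform variables. -/

section Step

variable {Ω : Type*} {𝓖 : MeasurableSpace Ω} {mΩ : MeasurableSpace Ω} {μ : Measure Ω}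
  {X : Type*} {N : Ω → X}

/-- No regularity of `φ` is needed because `N` has finitely many values; this matters for maps
obtained by choice. -/
theorem stronglyMeasurable_comp_of_finite_range {Y : Type*} [TopologicalSpace Y]
    (hfin : (Set.range N).Finite) (hN : ∀ c, MeasurableSet[𝓖] (N ⁻¹' {c})) (φ : X → Y) :
    StronglyMeasurable[𝓖] fun ω => φ (N ω) :=
  (SimpleFunc.map φ (@SimpleFunc.mk Ω 𝓖 X N hN hfin)).stronglyMeasurable

/-- Integrating a step function driven by an independent variable amounts to integrating its
mean. -/
theorem setIntegral_step_eq [IsProbabilityMeasure μ] [NormedAddCommGroup X] [NormedSpace ℝ X] [CompleteSpace X]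
    (h𝓖 : 𝓖 ≤ mΩ)
    (hfin : (Set.range N).Finite) (hN : ∀ c, MeasurableSet[𝓖] (N ⁻¹' {c}))
    {I : Type*} [mI : MeasurableSpace I] {ν : Measure I} {U : Ω → I} (hU : MeasurePreserving U μ ν)
    (hind : ProbabilityTheory.Indep (mI.comap U) 𝓖 μ) (s : X → SimpleFunc I X)
    {A : Set Ω} (hA : MeasurableSet[𝓖] A) :
    ∫ ω in A, s (N ω) (U ω) ∂μ = ∫ ω in A, (∫ u, s (N ω) u ∂ν) ∂μ := by
  classical
  have hcov : A = ⋃ p ∈ hfin.toFinset, A ∩ N ⁻¹' {p} := by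
    ext ω
    simp
  have hmeas : ∀ p, MeasurableSet[𝓖] (A ∩ N ⁻¹' {p}) := fun p => hA.inter (hN p)
  have hdisj : Set.Pairwise (hfin.toFinset : Set X) (Function.onFun Disjoint fun p =>
      A ∩ N ⁻¹' {p}) := by
    intro p _ q _ hpq
    refine Set.disjoint_left.2 fun ω h1 h2 => hpq ?_
    rw [← h1.2, ← h2.2]
  have hsU : ∀ p, StronglyMeasurable[mI.comap U] fun ω => s p (U ω) := fun p =>
    (s p).stronglyMeasurable.comp_measurable (comap_measurable U)
  have hsi : ∀ p, Integrable (fun ω => s p (U ω)) μ := fun p =>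
    integrable_of_finite_range ((hsU p).mono hU.measurable.comap_le)
      ((s p).finite_range.subset (by rintro _ ⟨ω, rfl⟩; exact ⟨_, rfl⟩))
  rw [hcov, integral_biUnion_finset _ (fun p _ => h𝓖 _ (hmeas p)) hdisj,
    integral_biUnion_finset _ (fun p _ => h𝓖 _ (hmeas p)) hdisj]
  · refine Finset.sum_congr rfl fun p _ => ?_
    have hp := h𝓖 _ (hmeas p)
    rw [setIntegral_congr_fun (g := fun ω => s p (U ω)) hp fun ω hω => by
        simp only [show N ω = p from hω.2],
      setIntegral_congr_fun (f := fun ω => ∫ u, s (N ω) u ∂ν)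
        (g := fun _ => ∫ u, s p u ∂ν) hp fun ω hω => by
        simp only [show N ω = p from hω.2],
      ← setIntegral_condExp h𝓖 (hsi p) (hmeas p)]
    refine setIntegral_congr_ae hp ?_
    -- On the piece `N = p` only `s p (U ω)` remains; by independence its conditional expectation
    -- given `𝓖` is its mean.
    filter_upwards [condExp_indep_eq hU.measurable.comap_le h𝓖 (hsU p) hind] with ω hω _
    rw [hω, ← hU.map_eq,
      integral_map hU.measurable.aemeasurable (s p).stronglyMeasurable.aestronglyMeasurable]
  · intro p _
    exact (integrable_of_finite_range ((stronglyMeasurable_comp_of_finite_range hfin hN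
      fun p => ∫ u, s p u ∂ν).mono h𝓖) ((hfin.image fun p => ∫ u, s p u ∂ν).subset (by
        rintro _ ⟨ω, rfl⟩; exact ⟨_, ⟨ω, rfl⟩, rfl⟩))).integrableOn
  · intro p _
    refine IntegrableOn.congr_fun (hsi p).integrableOn (fun ω hω => ?_) (h𝓖 _ (hmeas p))
    simp only [show N ω = p from hω.2]

end Step

/-- In a space with the Radon–Nikodým property, near every nonzero functional there is one that
does not attain its norm away from a suitable point of the unit ball. -/
theorem HasRadonNikodymProperty.exists_not_attains_away {X : Type*} [NormedAddCommGroup X]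
    [NormedSpace ℝ X] [CompleteSpace X] (hX : HasRadonNikodymProperty X) {F : X →L[ℝ] ℝ}
    {r δ : ℝ} (hr : 0 < r) (hrF : r < ‖F‖) (hδ : 0 < δ) :
    ∃ p : X, ‖p‖ ≤ 1 ∧ ∃ G : X →L[ℝ] ℝ, ‖G - F‖ ≤ r ∧
      ∀ z, ‖z‖ ≤ 1 → δ ≤ ‖z - p‖ → G z ≠ ‖G‖ := by
  by_contra! hcon
  have hstep : ∀ (n : ℕ) (p : X), ‖p‖ ≤ 1 → ∃ (s : SimpleFunc unitInterval X) (k : X),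
      (∀ u, ‖s u‖ ≤ 1 ∧ δ ≤ ‖s u - p‖) ∧ r * ‖k‖ ≤ F k ∧
        ‖(∫ u, s u) - k - p‖ < (1 / 2 : ℝ) ^ n := by
    intro n p hp
    obtain ⟨q, hq, k, hk, hqk⟩ := exists_convexHull_sub_cone_near hr.le hrF hp (hcon p hp)
      (e := (1 / 2 : ℝ) ^ n) (by positivity)
    obtain ⟨s, hs, rfl⟩ := exists_simpleFunc_integral_eq_of_mem_convexHull hq
    exact ⟨s, k, hs, hk, hqk⟩
  choose! s k hs hk hsk using hstep
  let Ω := ℕ → unitInterval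
  let μ : Measure Ω := Measure.infinitePi fun _ => volume
  -- Only coordinates `i < n` enter: `M n` is determined by them, and coordinate `n`, which drives
  -- the next step, is independent of `𝓕 n`.
  let 𝓕 : ℕ → MeasurableSpace Ω := fun n =>
    ⨆ i ∈ Set.Iio n, MeasurableSpace.comap (fun ω : Ω => ω i) inferInstance
  let M : ℕ → Ω → X := fun n => Nat.rec (fun _ => 0) (fun n f ω => s n (f ω) (ω n)) n
  have hM0 : ∀ ω, M 0 ω = 0 := fun ω => rfl
  have hMs : ∀ n ω, M (n + 1) ω = s n (M n ω) (ω n) := fun n ω => rfl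
  have hmono : Monotone 𝓕 := fun a b hab =>
    biSup_mono fun i hi => lt_of_lt_of_le (Set.mem_Iio.1 hi) hab
  have hcoord : ∀ i n, i < n → MeasurableSpace.comap (fun ω : Ω => ω i) inferInstance ≤ 𝓕 n :=
    fun i n hi => le_iSup₂_of_le i hi le_rfl
  have hsup : ⨆ n, 𝓕 n = MeasurableSpace.pi := by
    refine le_antisymm (iSup_le fun n => iSup₂_le fun i _ =>
      (measurable_pi_apply i).comap_le) ?_
    exact iSup_le fun i => (hcoord i (i + 1) (Nat.lt_succ_self i)).trans (le_iSup 𝓕 (i + 1))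
  have hle : ∀ n, 𝓕 n ≤ MeasurableSpace.pi := fun n => hsup ▸ le_iSup 𝓕 n
  have hbd : ∀ n ω, ‖M n ω‖ ≤ 1 := by
    intro n
    induction n with
    | zero => intro ω; simp [hM0]
    | succ n ih => intro ω; rw [hMs]; exact (hs n _ (ih ω) _).1
  have hfinmeas : ∀ n, (Set.range (M n)).Finite ∧ ∀ c, MeasurableSet[𝓕 n] (M n ⁻¹' {c}) := by
    intro n
    induction n with
    | zero =>
      refine ⟨(Set.finite_singleton 0).subset (by rintro _ ⟨ω, rfl⟩; exact hM0 ω), fun c => ?_⟩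
      exact @MeasurableSet.const _ (𝓕 0) ((0 : X) = c)
    | succ n ih =>
      constructor
      · refine (ih.1.biUnion fun p _ => (s n p).finite_range).subset ?_
        rintro _ ⟨ω, rfl⟩
        exact Set.mem_biUnion ⟨ω, rfl⟩ ⟨ω n, rfl⟩
      · intro c
        have heq : M (n + 1) ⁻¹' {c} = ⋃ p ∈ Set.range (M n),
            (M n ⁻¹' {p} ∩ (fun ω : Ω => ω n) ⁻¹' (s n p ⁻¹' {c})) := by
          ext ω
          simp only [Set.mem_iUnion₂, Set.mem_inter_iff, Set.mem_preimage, Set.mem_singleton_iff,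
            hMs, exists_prop]
          exact ⟨fun h => ⟨M n ω, ⟨ω, rfl⟩, rfl, h⟩, fun ⟨p, _, hp, h⟩ => by rwa [hp]⟩
        rw [heq]
        refine MeasurableSet.biUnion ih.1.countable fun p _ => ?_
        exact (hmono n.le_succ _ (ih.2 p)).inter
          (hcoord n (n + 1) n.lt_succ_self _ ⟨_, (s n p).measurableSet_fiber c, rfl⟩)
  have hcomp : ∀ n (φ : X → X), StronglyMeasurable[𝓕 n] fun ω => φ (M n ω) := fun n φ =>
    stronglyMeasurable_comp_of_finite_range (hfinmeas n).1 (hfinmeas n).2 φ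
  have hcompi : ∀ n (φ : X → X), Integrable (fun ω => φ (M n ω)) μ := fun n φ =>
    integrable_of_finite_range ((hcomp n φ).mono (hle n)) (((hfinmeas n).1.image φ).subset (by
      rintro _ ⟨ω, rfl⟩; exact ⟨_, ⟨ω, rfl⟩, rfl⟩))
  have hMi : ∀ n, Integrable (M n) μ := fun n => hcompi n id
  have hind : ∀ n, ProbabilityTheory.Indep
      (MeasurableSpace.comap (fun ω : Ω => ω n) inferInstance) (𝓕 n) μ := by
    intro n
    have h1 : ProbabilityTheory.iIndepFun (fun (i : ℕ) (ω : Ω) => ω i) μ :=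
      ProbabilityTheory.iIndepFun_infinitePi (P := fun _ : ℕ => (volume : Measure unitInterval))
        (X := fun _ u => u) fun _ => measurable_id
    have h2 := ProbabilityTheory.indep_iSup_of_disjoint
      (fun i => (measurable_pi_apply i).comap_le) h1.iIndep (S := {n}) (T := Set.Iio n) (by simp)
    rwa [iSup_singleton] at h2
  let q : ℕ → X → X := fun n p => ∫ u, s n p u
  have hstepint : ∀ n A, MeasurableSet[𝓕 n] A →
      ∫ ω in A, M (n + 1) ω ∂μ = ∫ ω in A, q n (M n ω) ∂μ := fun n A hA =>
    setIntegral_step_eq (hle n) (hfinmeas n).1 (hfinmeas n).2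
      (measurePreserving_eval_infinitePi (fun _ : ℕ => (volume : Measure unitInterval)) n)
      (hind n) (s n) hA
  let d : ℕ → Ω → ℝ := fun n ω => ‖k n (M n ω)‖ + (1 / 2 : ℝ) ^ n
  have hdi : ∀ n, Integrable (d n) μ := fun n => (hcompi n (k n)).norm.add (integrable_const _)
  have hd0 : ∀ n ω, 0 ≤ d n ω := fun n ω => by positivity
  have hdM : ∀ n A, MeasurableSet[𝓕 n] A →
      ‖∫ ω in A, M (n + 1) ω ∂μ - ∫ ω in A, M n ω ∂μ‖ ≤ ∫ ω in A, d n ω ∂μ := by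
    intro n A hA
    rw [hstepint n A hA, ← integral_sub (hcompi n (q n)).integrableOn (hMi n).integrableOn]
    refine norm_integral_le_of_norm_le (hdi n).integrableOn (ae_of_all _ fun ω => ?_)
    have h1 := (hsk n (M n ω) (hbd n ω)).le
    have h2 := norm_add_le (k n (M n ω)) (q n (M n ω) - k n (M n ω) - M n ω)
    rw [show k n (M n ω) + (q n (M n ω) - k n (M n ω) - M n ω) = q n (M n ω) - M n ω by abel] at h2
    exact h2.trans (add_le_add le_rfl h1)
  have hgeo : Summable fun n : ℕ => (1 / 2 : ℝ) ^ n := summable_geometric_two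
  -- The cone condition `r * ‖k‖ ≤ F k` bounds the mean drift by the increase of the mean of `F`, up
  -- to the step error; the increases telescope in `hksum`.
  have hkle : ∀ n, r * ∫ ω, ‖k n (M n ω)‖ ∂μ ≤
      (F (∫ ω, M (n + 1) ω ∂μ) - F (∫ ω, M n ω ∂μ)) + ‖F‖ * (1 / 2 : ℝ) ^ n := by
    intro n
    have h1 := hstepint n Set.univ (@MeasurableSet.univ _ (𝓕 n))
    rw [setIntegral_univ, setIntegral_univ] at h1
    rw [h1, ← F.integral_comp_comm (hcompi n (q n)), ← F.integral_comp_comm (hMi n),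
      ← integral_sub (F.integrable_comp (hcompi n (q n))) (F.integrable_comp (hMi n)),
      ← integral_const_mul]
    have h2 : ‖F‖ * (1 / 2 : ℝ) ^ n = ∫ _, ‖F‖ * (1 / 2 : ℝ) ^ n ∂μ := by simp
    have hFi : Integrable (fun ω => F (q n (M n ω)) - F (M n ω)) μ :=
      (F.integrable_comp (hcompi n (q n))).sub (F.integrable_comp (hMi n))
    rw [h2, ← integral_add hFi (integrable_const _)]
    refine integral_mono ((hcompi n (k n)).norm.const_mul r) (hFi.add (integrable_const _))
      fun ω => ?_
    change r * ‖k n (M n ω)‖ ≤ F (q n (M n ω)) - F (M n ω) + ‖F‖ * (1 / 2 : ℝ) ^ n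
    have h3 := hk n (M n ω) (hbd n ω)
    have h4 := F.le_opNorm (q n (M n ω) - k n (M n ω) - M n ω)
    have h5 := mul_le_mul_of_nonneg_left (hsk n (M n ω) (hbd n ω)).le (norm_nonneg F)
    have h6 := neg_le_of_abs_le (h4.trans h5)
    simp only [map_sub] at h6
    linarith
  have hFM : ∀ n, F (∫ ω, M n ω ∂μ) ≤ ‖F‖ := by
    intro n
    have h1 : ‖∫ ω, M n ω ∂μ‖ ≤ 1 := by
      simpa using norm_integral_le_of_norm_le_const (μ := μ) (ae_of_all _ (hbd n))
    exact (le_abs_self _).trans ((F.le_opNorm _).trans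
      (mul_le_of_le_one_right (norm_nonneg _) h1))
  have hksum : Summable fun n => ∫ ω, ‖k n (M n ω)‖ ∂μ := by
    refine summable_of_sum_range_le (c := (‖F‖ + ‖F‖ * ∑' n : ℕ, (1 / 2 : ℝ) ^ n) / r)
      (fun n => integral_nonneg fun _ => norm_nonneg _) fun n => ?_
    rw [le_div_iff₀ hr, mul_comm, Finset.mul_sum]
    refine (Finset.sum_le_sum fun i _ => hkle i).trans ?_
    rw [Finset.sum_add_distrib, Finset.sum_range_sub fun n => F (∫ ω, M n ω ∂μ),
      ← Finset.mul_sum]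
    have h1 : F (∫ ω, M 0 ω ∂μ) = 0 := by simp [hM0]
    rw [h1, sub_zero]
    exact add_le_add (hFM n) (mul_le_mul_of_nonneg_left
      (hgeo.sum_le_tsum _ fun i _ => by positivity) (norm_nonneg F))
  have hsum : Summable fun n => ∫ ω, d n ω ∂μ := by
    refine (hksum.add hgeo).congr fun n => ?_
    rw [integral_add (hcompi n (k n)).norm (integrable_const _)]
    simp
  exact hX.false_of_separated_quasimartingale hmono hsup (fun n => hcomp n id)
    (fun n => (hfinmeas n).1) hbd hd0 hdi hdM hsum hδ
    fun n ω => by rw [hMs]; exact (hs n _ (hbd n ω) _).2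

/-! ### Norm attainment and the two implications. -/

section Lop

variable {𝕜 X : Type*} [RCLike 𝕜] [NormedAddCommGroup X] [NormedSpace 𝕜 X]

/-- In a reflexive space every nonzero functional attains its norm on the unit sphere. -/
theorem IsReflexiveSpace.exists_norm_eq_one_apply_eq (hX : IsReflexiveSpace 𝕜 X)
    {T : X →L[𝕜] 𝕜} (hT : T ≠ 0) : ∃ x, ‖x‖ = 1 ∧ T x = ‖T‖ := by
  obtain ⟨φ, hφ, hφT⟩ := exists_dual_vector 𝕜 T (norm_ne_zero_iff.2 hT)
  obtain ⟨x, rfl⟩ := hX φ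
  refine ⟨x, ?_, by rwa [NormedSpace.dual_def] at hφT⟩
  rw [← hφ]
  exact ((NormedSpace.inclusionInDoubleDualLi 𝕜 (E := X)).norm_map x).symm

theorem hasPropertyLop_of_reflexive_of_locallyUniformlyRotund (hX : IsReflexiveSpace 𝕜 X)
    (hLUR : IsLocallyUniformlyRotund X) : HasPropertyLop 𝕜 X 𝕜 := by
  intro ε hε x hx
  by_contra! hcon
  choose! T hT hTx hfar using fun n : ℕ => hcon (1 / ((n : ℝ) + 1)) (by positivity)
  have hne : ∀ n, T n ≠ 0 := fun n h => by simpa [h] using hT n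
  choose w hw hTw using fun n => hX.exists_norm_eq_one_apply_eq (hne n)
  -- Rotating `w n` by the phase `c n` of `T n x` aligns the two values, so that `T n (u n + x)` has
  -- modulus `1 + ‖T n x‖`.
  have hphase : ∀ n, ∃ c : 𝕜, ‖c‖ = 1 ∧ c * ‖T n x‖ = T n x := fun n => by
    obtain ⟨c, hc, h⟩ := RCLike.exists_norm_mul_eq_self (T n x)
    exact ⟨c, hc, h⟩
  choose c hc hcT using hphase
  let u : ℕ → X := fun n => c n • w n
  have hu : ∀ n, ‖u n‖ = 1 := fun n => by simp [u, norm_smul, hc, hw]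
  have hTu : ∀ n, T n (u n) = c n := fun n => by simp [u, hTw, hT]
  have hlow : ∀ n, 1 + ‖T n x‖ ≤ ‖u n + x‖ := by
    intro n
    have h1 := (T n).le_opNorm (u n + x)
    rw [hT, one_mul, map_add, hTu, ← hcT n] at h1
    have h2 : c n + c n * (‖T n x‖ : 𝕜) = c n * ((1 + ‖T n x‖ : ℝ) : 𝕜) := by
      push_cast; ring
    rw [h2, norm_mul, hc, one_mul, RCLike.norm_ofReal, abs_of_nonneg (by positivity)] at h1
    exact h1
  have hlim : Tendsto (fun n => ‖u n + x‖) atTop (𝓝 2) := by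
    have h0 : Tendsto (fun n : ℕ => 2 - 1 / ((n : ℝ) + 1)) atTop (𝓝 2) := by
      simpa using tendsto_one_div_add_atTop_nhds_zero_nat.const_sub (2 : ℝ)
    refine tendsto_of_tendsto_of_tendsto_of_le_of_le h0 tendsto_const_nhds (fun n => ?_)
      fun n => ?_
    · have := hlow n
      have := hTx n
      change 2 - 1 / ((n : ℝ) + 1) ≤ _
      linarith
    · have := norm_add_le (u n) x
      rw [hu, hx] at this
      change _ ≤ (2 : ℝ)
      linarith
  have hzero := hLUR x hx u hu hlim
  obtain ⟨n, hn⟩ := (hzero.eventually (gt_mem_nhds hε)).exists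
  exact absurd hn (not_lt.2 (hfar n (u n) (hu n) (by rw [hTu, hc])))

/-- Under property `L_{o,p}`, functionals near a norm-one functional `f` with `f x = 1` attain
their norm near `x`. -/
theorem HasPropertyLop.exists_attaining_near (hL : HasPropertyLop 𝕜 X 𝕜) {f : X →L[𝕜] 𝕜}
    (hf : ‖f‖ = 1) {x : X} (hx : ‖x‖ = 1) (hfx : f x = 1) {ε : ℝ} (hε : 0 < ε) :
    ∃ ρ : ℝ, 0 < ρ ∧ ∀ g : X →L[𝕜] 𝕜, ‖g - f‖ ≤ ρ →
      ∃ z, ‖z‖ = 1 ∧ g z = ‖g‖ ∧ ‖z - x‖ < ε := by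
  obtain ⟨η, hη, h⟩ := hL (ε / 4) (by positivity) x hx
  -- The bound `1 / 2` keeps `g ≠ 0`, `η / 4` gives `‖T x‖ ≥ 1 - 2 * ρ > 1 - η` for the normalised
  -- `T`, and `ε / 8` keeps the final rotation small.
  let ρ : ℝ := min (1 / 2) (min (ε / 8) (η / 4))
  have hρ1 : ρ ≤ 1 / 2 := min_le_left _ _
  have hρ2 : ρ ≤ ε / 8 := (min_le_right _ _).trans (min_le_left _ _)
  have hρ3 : ρ ≤ η / 4 := (min_le_right _ _).trans (min_le_right _ _)
  refine ⟨ρ, by positivity, fun g hg => ?_⟩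
  have hg1 : |‖g‖ - 1| ≤ ρ := by
    rw [← hf]
    exact (abs_norm_sub_norm_le g f).trans hg
  obtain ⟨hg2, hg3⟩ := abs_le.1 hg1
  have hgpos : 0 < ‖g‖ := by linarith
  have hgne : ((‖g‖ : ℝ) : 𝕜) ≠ 0 := by exact_mod_cast hgpos.ne'
  let T : X →L[𝕜] 𝕜 := ((‖g‖ : ℝ) : 𝕜)⁻¹ • g
  have hT : ‖T‖ = 1 := by
    simp only [T, norm_smul, norm_inv, RCLike.norm_ofReal, abs_norm]
    exact inv_mul_cancel₀ hgpos.ne'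
  have hgT : g = ((‖g‖ : ℝ) : 𝕜) • T := by simp [T, smul_smul, hgne]
  have hTg : ‖T - g‖ ≤ ρ := by
    have h1 : T - g = ((1 - ‖g‖ : ℝ) : 𝕜) • T := by
      ext w
      have h2 : g w = ((‖g‖ : ℝ) : 𝕜) * T w := DFunLike.congr_fun hgT w
      change T w - g w = ((1 - ‖g‖ : ℝ) : 𝕜) * T w
      rw [RCLike.ofReal_sub, RCLike.ofReal_one, sub_mul, one_mul, ← h2]
    rw [h1, norm_smul, hT, mul_one, RCLike.norm_ofReal, abs_sub_comm]
    exact hg1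
  have hTf : ‖T - f‖ ≤ 2 * ρ := by
    have := norm_sub_le_norm_sub_add_norm_sub T g f
    linarith
  have hTx : ‖T x - 1‖ ≤ 2 * ρ := by
    have := (T - f).le_opNorm x
    rw [hx, mul_one, sub_apply, hfx] at this
    exact this.trans hTf
  obtain ⟨x₀, hx₀, hTx₀, hclose⟩ := h T hT (by
    have h1 := norm_sub_norm_le (1 : 𝕜) (T x)
    rw [norm_one, norm_sub_rev] at h1
    linarith)
  -- The rotation by `c` makes the attained value positive. It moves `x₀` little, since `T x₀` is
  -- close to `T x` and hence to 1.
  let c : 𝕜 := starRingEnd 𝕜 (T x₀)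
  have hc : c * T x₀ = 1 := by
    simp [c, RCLike.conj_mul, hTx₀]
  have hcn : ‖c‖ = 1 := by simp [c, hTx₀]
  have hc1 : ‖c - 1‖ ≤ ε / 4 + 2 * ρ := by
    have h1 : c - 1 = starRingEnd 𝕜 (T x₀ - 1) := by simp [c]
    rw [h1, RCLike.norm_conj]
    have h2 := T.le_opNorm (x₀ - x)
    rw [hT, one_mul, map_sub] at h2
    have := norm_sub_le_norm_sub_add_norm_sub (T x₀) (T x) 1
    linarith
  refine ⟨c • x₀, by rw [norm_smul, hcn, hx₀, one_mul], ?_, ?_⟩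
  · nth_rewrite 1 [hgT]
    simp only [smul_apply, map_smul, smul_eq_mul]
    rw [mul_left_comm, hc, mul_one]
  · have h1 : c • x₀ - x₀ = (c - 1) • x₀ := by rw [sub_smul, one_smul]
    have h2 := norm_sub_le_norm_sub_add_norm_sub (c • x₀) x₀ x
    rw [h1, norm_smul, hx₀, mul_one] at h2
    linarith

/-- This is extremality of 1 in the unit disc: both real parts must equal 1, leaving no room for an
imaginary part. -/
theorem eq_one_of_norm_le_one_of_add_eq_two {a b : 𝕜} (ha : ‖a‖ ≤ 1) (hb : ‖b‖ ≤ 1)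
    (hab : a + b = 2) : a = 1 := by
  have h1 := congrArg RCLike.re hab
  simp only [map_add, RCLike.ofNat_re] at h1
  have h2 := RCLike.re_le_norm a
  have h3 := RCLike.re_le_norm b
  have h4 : RCLike.re a = 1 := by linarith
  rw [← RCLike.re_eq_self_of_le (a := a) (by linarith), h4, RCLike.ofReal_one]

theorem isStrictlyConvexSpace_of_radonNikodym_of_hasPropertyLop [NormedSpace ℝ X]
    [IsScalarTower ℝ 𝕜 X] [CompleteSpace X] (hX : HasRadonNikodymProperty X)
    (hL : HasPropertyLop 𝕜 X 𝕜) : IsStrictlyConvexSpace 𝕜 X := by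
  intro x y hx hy hxy
  by_contra! hge
  let v : X := (2⁻¹ : 𝕜) • (x + y)
  have hv : ‖v‖ = 1 := by
    refine le_antisymm ?_ hge
    have := norm_add_le x y
    simp only [v, norm_smul, norm_inv, RCLike.norm_ofNat]
    linarith
  obtain ⟨f, hf, hfv⟩ := exists_dual_vector 𝕜 v (by rw [hv]; exact one_ne_zero)
  have hsum : f x + f y = 2 := by
    have h1 : (2⁻¹ : 𝕜) * (f x + f y) = 1 := by
      rwa [hv, map_smul, map_add, smul_eq_mul, RCLike.ofReal_one] at hfv
    field_simp at h1
    exact h1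
  have hfle : ∀ w : X, ‖w‖ = 1 → ‖f w‖ ≤ 1 := fun w hw => by
    simpa [hf, hw] using f.le_opNorm w
  have hfx : f x = 1 := eq_one_of_norm_le_one_of_add_eq_two (hfle x hx) (hfle y hy) hsum
  have hfy : f y = 1 := eq_one_of_norm_le_one_of_add_eq_two (hfle y hy) (hfle x hx)
    (by rw [add_comm, hsum])
  have hδ : 0 < ‖x - y‖ := norm_pos_iff.2 (sub_ne_zero.2 hxy)
  obtain ⟨ρ₁, hρ₁, h₁⟩ := hL.exists_attaining_near hf hx hfx (ε := ‖x - y‖ / 4) (by positivity)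
  obtain ⟨ρ₂, hρ₂, h₂⟩ := hL.exists_attaining_near hf hy hfy (ε := ‖x - y‖ / 4) (by positivity)
  -- Taking real parts identifies the two duals isometrically, so the separation argument over `ℝ`
  -- applies to `f`.
  let e : StrongDual ℝ X ≃ₗᵢ[ℝ] StrongDual 𝕜 X := StrongDual.extendRCLikeₗᵢ
  let F : X →L[ℝ] ℝ := e.symm f
  have hF : ‖F‖ = 1 := by rw [← hf]; exact e.symm.norm_map f
  -- The quarter is for the chain `x, a, p, b, y`: four links, each shorter than `‖x - y‖ / 4`,
  -- cannot join `x` to `y`.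
  obtain ⟨p, -, G, hG, hno⟩ := hX.exists_not_attains_away (F := F)
    (r := min (1 / 2) (min ρ₁ ρ₂)) (δ := ‖x - y‖ / 4) (by positivity)
    (by rw [hF]; exact (min_le_left _ _).trans_lt (by norm_num)) (by positivity)
  have hgf : ‖e G - f‖ ≤ min (1 / 2) (min ρ₁ ρ₂) := by
    have h3 : e G - f = e (G - F) := by rw [map_sub]; simp [F]
    rw [h3, e.norm_map]
    exact hG
  have hre : ∀ w, (e G) w = ((‖e G‖ : ℝ) : 𝕜) → G w = ‖G‖ := fun w hw => by
    have h4 : RCLike.re ((e G) w) = G w := StrongDual.re_extendRCLike_apply G w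
    rw [← h4, hw, RCLike.ofReal_re, e.norm_map]
  obtain ⟨a, ha, hga, hax⟩ := h₁ (e G) (hgf.trans ((min_le_right _ _).trans (min_le_left _ _)))
  obtain ⟨b, hb, hgb, hby⟩ := h₂ (e G) (hgf.trans ((min_le_right _ _).trans (min_le_right _ _)))
  have ha' : ‖a - p‖ < ‖x - y‖ / 4 := by
    by_contra! h
    exact hno a ha.le h (hre a hga)
  have hb' : ‖b - p‖ < ‖x - y‖ / 4 := by
    by_contra! h
    exact hno b hb.le h (hre b hgb)
  have h5 := norm_sub_le_norm_sub_add_norm_sub x a y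
  have h6 := norm_sub_le_norm_sub_add_norm_sub a p y
  have h7 := norm_sub_le_norm_sub_add_norm_sub p b y
  rw [norm_sub_rev x a] at h5
  rw [norm_sub_rev p b] at h7
  linarith

end Lop

/-- The real structure `[NormedSpace ℝ X]` is the restriction of scalars of the `𝕜`-structure. -/
theorem proposition2p1 {𝕜 X : Type*} [RCLike 𝕜] [NormedAddCommGroup X] [NormedSpace 𝕜 X]
    [NormedSpace ℝ X] [IsScalarTower ℝ 𝕜 X] [CompleteSpace X] :
    (IsReflexiveSpace 𝕜 X → IsLocallyUniformlyRotund X → HasPropertyLop 𝕜 X 𝕜) ∧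
    (HasRadonNikodymProperty X → HasPropertyLop 𝕜 X 𝕜 → IsStrictlyConvexSpace 𝕜 X) :=
  ⟨hasPropertyLop_of_reflexive_of_locallyUniformlyRotund,
    isStrictlyConvexSpace_of_radonNikodym_of_hasPropertyLop⟩
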